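/- Conventions. An \(\ell\)-server scheme \((\mathsf{Que},\mathsf{Ans},\mathsf{Rec})\) with security parameter \(\kappa\) works on databases \(x=(x_1,\dots,x_n)\in(\{0,1\}^m)^n\). The client runs the randomized algorithm \((q_1,\dots,q_\ell,\mathsf{aux})\leftarrow\mathsf{Que}(1^\kappa,n,\alpha)\) for its index \(\alpha\in[n]\), sends \(q_j\) to server \(j\), an honest server returns \(a_j=\mathsf{Ans}(x,q_j)\), and the client outputs \(y=\mathsf{Rec}(a_1,\dots,a_\ell,\mathsf{aux})\in\{0,1\}^m\cup\{\perp\}\). Queries and answers are bit strings, and the communication complexity is the total number of bits of all queries and answers. The scheme is an itAPIR scheme if it is *correct*: when all servers are honest, \(y=x_\alpha\) with probability \(1\), for all \(\kappa,n,m,x,\alpha\). * *\((t,\varepsilon)\)-integrity*, for a function \(\varepsilon\) of \(\kappa\): for all \(\kappa,n,m,x,\alpha\), every set of at most \(t\) servers, and every computationally unbounded randomized adversary that sees \(x\) and the queries to these servers and chooses their answers, \(\Pr[y\notin\{x_\alpha,\perp\}]\le\varepsilon(\kappa)\). * *Statistical \(t\)-privacy against selective-failure attacks*: for every set \(T\)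 of at most \(t\) servers there is a two-stage simulator \((\mathsf{Sim}_0,\mathsf{Sim}_1)\) (randomized Boolean circuits of size polynomial in \(\kappa,n,m\) and the message lengths) such that for every computationally unbounded two-stage adversary \((\mathcal A_0,\mathcal A_1)\), every database \(x\) and every index \(\alpha\), the outputs \(\beta\) of the following two experiments have statistical distance at most \(\nu(\kappa)\), where \(\nu\) is a negligible function that does not depend on \(n,m,x,\alpha,T\) or the adversary. Real: \((q,\mathsf{aux})\leftarrow\mathsf{Que}(1^\kappa,n,\alpha)\); \((\mathsf{st},(\tilde a_j)_{j\in T})\leftarrow\mathcal A_0(x,(q_j)_{j\in T})\); the other servers answer honestly; \(b=1\) if the client does not output \(\perp\), else \(b=0\); \(\beta\leftarrow\mathcal A_1(\mathsf{st},b)\). Ideal: \((\mathsf{st}_{\mathsf{Sim}},(q_j)_{j\in T})\leftarrow\mathsf{Sim}_0(1^\kappa,n,x,T)\); \((\mathsf{st},(\tilde a_j)_{j\in T})\leftarrow\mathcal A_0(x,(q_j)_{j\in T})\); \(b\leftarrow\mathsf{Sim}_1(\mathsf{st}_{\mathsf{Sim}},(\tilde a_j)_{j\in T})\); \(\beta\leftarrow\mathcal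 A_1(\mathsf{st},b)\). Theorem. There are functions \(u,v:\mathbb N\to\mathbb R\) with \(u(k)\to0\) and \(v(k)\to0\) as \(k\to\infty\) such that for all \(\ell\ge2\) and \(1\le t<\ell/2\), and for every \(\varepsilon:\mathbb N\to(0,1)\) (for instance a constant), there is an \(\ell\)-server itAPIR scheme that * is statistically \(t\)-private against selective-failure attacks, * has \((t,\varepsilon)\)-integrity, * has, for all \(\kappa\), all \(n\ge2\) and all \(m\ge1\), communication complexity at most \[ m\cdot n^{1/\lfloor(2(\ell-t)-1)/t\rfloor}\,\bigl(\log n+\log\varepsilon(\kappa)^{-1}\bigr)\,(\ell-t)^{1+u(\ell-t)}\,\ell^{2+v(\ell)} . \] In particular, for databases of bits (\(m=1\)) the communication complexity is \(n^{1/\lfloor(2(\ell-t)-1)/t\rfloor}(\log n+\log\varepsilon^{-1})(\ell-t)^{1+o(1)}\ell^{2+o(1)}\). -/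

import Mathlib

open Filter Topology

/-- Bit strings of length `k`. -/
abbrev Bits (k : ℕ) : Type := Fin k → Bool

/-- Databases `x = (x_1, …, x_n)` whose entries are blocks of `m` bits. -/
abbrev Database (n m : ℕ) : Type := Fin n → Bits m

/-- Statistical distance of two distributions on a finite set. -/
noncomputable def statDist {B : Type} [Fintype B] (P Q : PMF B) : ℝ :=
  (1 / 2) * ∑ b, |(P b).toReal - (Q b).toReal|

/-- A function of the security parameter is negligible if it decays faster than the inverse of
every polynomial. -/
def Negligible (ν : ℕ → ℝ) : Prop :=
  Asymptotics.SuperpolynomialDecay atTop (fun κ : ℕ => (κ : ℝ)) ν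

/-- A Boolean circuit with input bits indexed by `I` and output bits indexed by `O`. It is a list
of NAND gates; each gate reads two wires, where the wire `Sum.inl i` is the input bit `i` and the
wire `Sum.inr k` is the value of the gate number `k`. A wire that belongs to no earlier gate
carries the constant `false`. -/
structure Circuit (I O : Type) where
  /-- the gates, in the order of evaluation -/
  gates : List ((I ⊕ ℕ) × (I ⊕ ℕ))
  /-- the wires at which the outputs are read off -/
  out : O → I ⊕ ℕ

namespace Circuit

variable {I O : Type}

/-- The bit on a wire, given the input and the values of the gates evaluated so far. -/
def read (inp : I → Bool) (vals : List Bool) : I ⊕ ℕ → Bool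
  | Sum.inl i => inp i
  | Sum.inr k => vals.getD k false

/-- The values of all gates on a given input. -/
def gateValues (C : Circuit I O) (inp : I → Bool) : List Bool :=
  C.gates.foldl (fun vals g => vals ++ [!(read inp vals g.1 && read inp vals g.2)]) []

/-- The output of the circuit on a given input. -/
def eval (C : Circuit I O) (inp : I → Bool) : O → Bool :=
  fun o => read inp (C.gateValues inp) (C.out o)

/-- The size of a circuit: the number of its inputs, gates and outputs. -/
def size [Fintype I] [Fintype O] (C : Circuit I O) : ℕ :=
  Fintype.card I + C.gates.length + Fintype.card O

/-- A circuit with `r` additional input bits, run on `r` independent fair coins. -/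
noncomputable def run {r : ℕ} (C : Circuit (I ⊕ Fin r) O) (inp : I → Bool) : PMF (O → Bool) :=
  (PMF.uniformOfFintype (Bits r)).map fun coins => C.eval (Sum.elim inp coins)

end Circuit

/-- An `ℓ`-server scheme `(Que, Ans, Rec)`. All queries and all answers are bit strings, of lengths
that depend on the public parameters only: the security parameter `κ`, the number `n` of database
entries and (for the answers) the entry size `m`. -/
structure APIRScheme (ℓ : ℕ) where
  /-- length of a query -/
  qlen : (κ n : ℕ) → ℕ
  /-- length of an answer -/
  alen : (κ n m : ℕ) → ℕ
  /-- auxiliary information that the client keeps for the reconstruction -/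
  Aux : (κ n : ℕ) → Type
  /-- the randomized querying algorithm -/
  que : (κ n : ℕ) → (α : Fin n) → PMF ((Fin ℓ → Bits (qlen κ n)) × Aux κ n)
  /-- the deterministic answering algorithm of the servers -/
  ans : (κ n m : ℕ) → Database n m → Bits (qlen κ n) → Bits (alen κ n m)
  /-- the deterministic reconstructing algorithm; `none` is the rejection symbol `⊥` -/
  recon : (κ n m : ℕ) → (Fin ℓ → Bits (alen κ n m)) → Aux κ n → Option (Bits m)

namespace APIRScheme

variable {ℓ : ℕ} (Γ : APIRScheme ℓ)

/-- Total number of bits exchanged between the client and the `ℓ` servers. -/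
def communication (κ n m : ℕ) : ℕ := ℓ * (Γ.qlen κ n + Γ.alen κ n m)

/-- The queries received by the servers in `T`. -/
abbrev QueriesTo (T : Finset (Fin ℓ)) (κ n : ℕ) : Type := T → Bits (Γ.qlen κ n)

/-- Answers of the servers in `T`. -/
abbrev AnswersOf (T : Finset (Fin ℓ)) (κ n m : ℕ) : Type := T → Bits (Γ.alen κ n m)

/-- The output of the client if the servers in `T` send the answers `a'` and all other servers
answer honestly. -/
def output (T : Finset (Fin ℓ)) {κ n m : ℕ} (x : Database n m)
    (q : Fin ℓ → Bits (Γ.qlen κ n)) (aux : Γ.Aux κ n) (a' : Γ.AnswersOf T κ n m) :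
    Option (Bits m) :=
  Γ.recon κ n m (fun j => if h : j ∈ T then a' ⟨j, h⟩ else Γ.ans κ n m x (q j)) aux

/-- Correctness: if all servers are honest, the client recovers `x_α` with probability `1`. -/
def Correct : Prop :=
  ∀ (κ n m : ℕ) (x : Database n m) (α : Fin n),
    ((Γ.que κ n α).map fun p => Γ.recon κ n m (fun j => Γ.ans κ n m x (p.1 j)) p.2)
      (some (x α)) = 1

/-- The output of the client when the (randomized, unbounded) adversary `A` controls the servers
in `V`. -/
noncomputable def integrityExp (V : Finset (Fin ℓ)) {κ n m : ℕ}
    (A : Database n m → Γ.QueriesTo V κ n → PMF (Γ.AnswersOf V κ n m))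
    (x : Database n m) (α : Fin n) : PMF (Option (Bits m)) :=
  (Γ.que κ n α).bind fun p =>
    (A x fun j => p.1 j).map fun a' => Γ.output V x p.1 p.2 a'

/-- `(v, ε)`-integrity, where `ε` may depend on the security parameter: no coalition of at most
`v` servers makes the client output a value outside `{x_α, ⊥}` with probability above `ε κ`. -/
def Integrity (v : ℕ) (ε : ℕ → ℝ) : Prop :=
  ∀ (κ n m : ℕ) (x : Database n m) (α : Fin n) (V : Finset (Fin ℓ)), V.card ≤ v →
    ∀ A : Database n m → Γ.QueriesTo V κ n → PMF (Γ.AnswersOf V κ n m),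
      (Γ.integrityExp V A x α).toOuterMeasure {y | y ≠ some (x α) ∧ y ≠ none}
        ≤ ENNReal.ofReal (ε κ)

/-- A two-stage, randomized, computationally unbounded adversary that controls the servers in `T`,
with internal states in `St` and final outputs in `B`. -/
structure Adversary (T : Finset (Fin ℓ)) (κ n m : ℕ) (St B : Type) where
  /-- first stage: reads the queries, fixes a state and the answers of the servers in `T` -/
  stage0 : Database n m → Γ.QueriesTo T κ n → PMF (St × Γ.AnswersOf T κ n m)
  /-- second stage: learns whether the client accepted -/
  stage1 : St → Bool → PMF B

/-- A two-stage simulator for a coalition `T`, given by randomized circuits. The first stage reads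
the database and outputs a state of `stateLen` bits and simulated queries; the second stage reads
the state and the answers of the servers in `T` and outputs the simulated acceptance bit. Neither
stage has access to the retrieval index. -/
structure Simulator (T : Finset (Fin ℓ)) (κ n m : ℕ) where
  /-- length of the state -/
  stateLen : ℕ
  /-- number of coins of the first stage -/
  coins0 : ℕ
  /-- number of coins of the second stage -/
  coins1 : ℕ
  /-- first stage -/
  stage0 : Circuit ((Fin n × Fin m) ⊕ Fin coins0) (Fin stateLen ⊕ (T × Fin (Γ.qlen κ n)))
  /-- second stage -/
  stage1 : Circuit ((Fin stateLen ⊕ (T × Fin (Γ.alen κ n m))) ⊕ Fin coins1) Unit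

/-- The size of a simulator: the total size of its two circuits. -/
def Simulator.size {Γ : APIRScheme ℓ} {T : Finset (Fin ℓ)} {κ n m : ℕ}
    (S : Γ.Simulator T κ n m) : ℕ :=
  S.stage0.size + S.stage1.size

/-- The real experiment: the adversary sees the queries to `T`, chooses the answers of `T`, learns
whether the client accepts, and outputs `β`. -/
noncomputable def real {T : Finset (Fin ℓ)} {κ n m : ℕ} {St B : Type}
    (A : Γ.Adversary T κ n m St B) (x : Database n m) (α : Fin n) : PMF B :=
  (Γ.que κ n α).bind fun p =>
    (A.stage0 x fun j => p.1 j).bind fun sa =>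
      A.stage1 sa.1 (Γ.output T x p.1 p.2 sa.2).isSome

/-- The ideal experiment: the queries and the acceptance bit come from the simulator. -/
noncomputable def ideal {T : Finset (Fin ℓ)} {κ n m : ℕ} {St B : Type}
    (S : Γ.Simulator T κ n m) (A : Γ.Adversary T κ n m St B) (x : Database n m) : PMF B :=
  (S.stage0.run fun ij => x ij.1 ij.2).bind fun o =>
    (A.stage0 x fun j i => o (Sum.inr (j, i))).bind fun sa =>
      (S.stage1.run (Sum.elim (fun i => o (Sum.inl i)) fun ji => sa.2 ji.1 ji.2)).bind fun b =>
        A.stage1 sa.1 (b ())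

/-- Statistical `t`-privacy against selective-failure attacks: there are simulators of size
polynomial in the security parameter, the size of the database and the length of the messages,
such that for every unbounded adversary that controls at most `t` servers and every retrieval
index the real and the ideal experiment are at negligible statistical distance. -/
def StatPrivate (t : ℕ) : Prop :=
  ∃ S : (κ n m : ℕ) → (T : Finset (Fin ℓ)) → Γ.Simulator T κ n m,
    (∃ poly : Polynomial ℕ, ∀ (κ n m : ℕ) (T : Finset (Fin ℓ)), T.card ≤ t →
      (S κ n m T).size ≤ poly.eval (κ + n + m + Γ.qlen κ n + Γ.alen κ n m)) ∧
    ∃ ν : ℕ → ℝ, Negligible ν ∧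
      ∀ (κ n m : ℕ) (x : Database n m) (α : Fin n) (T : Finset (Fin ℓ)), T.card ≤ t →
        ∀ (St B : Type) [Fintype B] (A : Γ.Adversary T κ n m St B),
          statDist (Γ.real A x α) (Γ.ideal (S κ n m T) A x) ≤ ν κ

end APIRScheme

/-! Each bit position of the database gives a homogeneous multilinear polynomial of degree `D =
⌊(2(ℓ-t)-1)/t⌋`, with value `s ^ D * x_α` at `s` times the indicator point of `α`. The client draws
a random nonzero scalar `s` and a random curve of degree `t` through that point at parameter zero.
Each server gets one point of the curve and returns value and gradient there. By the chain rule this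
yields the value and the derivative of the restriction to the curve, which has degree at most `t * D
< 2(ℓ-t)`. Hence any `ℓ-t` honest answers determine its value at zero by Hermite interpolation
(`exists_hermite_functional`).

The client outputs some block consistent with `ℓ-t` answers. The honest block always is, so the
client never rejects, and its acceptance bit carries no information. Any `t` query points are
uniform (`map_que_queriesTo`), so a simulator that sends uniform queries and always accepts is
perfect.

For integrity, fix the queries to `t` servers including the corrupted ones; `s` is still uniform and
unknown to them. By linearity of interpolation, their deviation shifts the value at zero by `A + s *
B`, the `s`-term coming from the direction of the curve. A wrong block needs this shift to be `s ^
D` times a difference of bits in each position. Since `D ≥ 2`, at most `D + 1` scalars allow this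
(`card_affine_hits_le`, `card_wrongly_explained_le`). A union bound over the sets of `ℓ-t` servers
and a field with `3ℓ + ⌈log₂ ε⁻¹⌉` bits per element finish the proof. -/

/-! ### Database polynomials, their gradients and homogeneity. -/

section DatabasePolynomial

open Polynomial

variable {A : Type*} [CommRing A] {n D r : ℕ}

/-- A bit as an element of a ring. -/
def bitVal (A : Type*) [CommRing A] (b : Bool) : A := if b then 1 else 0

/-- The value at `z` of the homogeneous multilinear polynomial of degree `D` whose coefficients are
the bits of `x`; the index `i` is encoded by the monomial `∏ d, z (d, c i d)`. -/
def dbEval (c : Fin n → Fin D → Fin r) (x : Fin n → Bool) (z : Fin D × Fin r → A) : A :=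
  ∑ i, bitVal A (x i) * ∏ d, z (d, c i d)

/-- The gradient of the polynomial `dbEval c x`. -/
def dbGrad (c : Fin n → Fin D → Fin r) (x : Fin n → Bool) (z : Fin D × Fin r → A) :
    Fin D × Fin r → A :=
  fun k => ∑ i, if c i k.1 = k.2 then bitVal A (x i) * ∏ d ∈ Finset.univ.erase k.1, z (d, c i d)
    else 0

/-- The indicator of the variables in the monomial that encodes the index `α`. -/
def indexPoint (A : Type*) [CommRing A] (c : Fin n → Fin D → Fin r) (α : Fin n) :
    Fin D × Fin r → A :=
  fun k => if c α k.1 = k.2 then 1 else 0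

theorem map_bitVal {B : Type*} [CommRing B] (φ : A →+* B) (b : Bool) :
    φ (bitVal A b) = bitVal B b := by
  cases b <;> simp [bitVal]

theorem map_dbEval {B : Type*} [CommRing B] (φ : A →+* B) (c : Fin n → Fin D → Fin r)
    (x : Fin n → Bool) (z : Fin D × Fin r → A) :
    φ (dbEval c x z) = dbEval c x fun k => φ (z k) := by
  simp [dbEval, map_bitVal]

theorem map_dbGrad {B : Type*} [CommRing B] (φ : A →+* B) (c : Fin n → Fin D → Fin r)
    (x : Fin n → Bool) (z : Fin D × Fin r → A) (k : Fin D × Fin r) :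
    φ (dbGrad c x z k) = dbGrad c x (fun k => φ (z k)) k := by
  simp [dbGrad, map_bitVal, apply_ite φ]

theorem derivative_bitVal (b : Bool) : derivative (bitVal A[X] b) = 0 := by
  cases b <;> simp [bitVal]

/-- The chain rule along a parametrized curve `P`. It lets the client, who knows the velocity, turn
a gradient into a derivative of the restriction. -/
theorem derivative_dbEval (c : Fin n → Fin D → Fin r) (x : Fin n → Bool)
    (P : Fin D × Fin r → A[X]) :
    derivative (dbEval c x P) = ∑ k, dbGrad c x P k * derivative (P k) := by
  simp only [dbEval, dbGrad, derivative_sum, derivative_mul, derivative_bitVal, zero_mul, zero_add,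
    derivative_prod_finset, Finset.sum_mul, Finset.mul_sum]
  refine Eq.trans ?_ Finset.sum_comm
  refine Finset.sum_congr rfl fun i _ => ?_
  rw [Fintype.sum_prod_type]
  refine Finset.sum_congr rfl fun d _ => ?_
  simp [ite_mul, mul_assoc]

theorem natDegree_dbEval_le (c : Fin n → Fin D → Fin r) (x : Fin n → Bool)
    (P : Fin D × Fin r → A[X]) (t : ℕ) (hP : ∀ k, (P k).natDegree ≤ t) :
    (dbEval c x P).natDegree ≤ t * D := by
  refine natDegree_sum_le_of_forall_le _ _ fun i _ => ?_
  have h1 : (∏ d, P (d, c i d)).natDegree ≤ t * D := by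
    refine (natDegree_prod_le _ _).trans ((Finset.sum_le_sum fun d _ => hP (d, c i d)).trans ?_)
    simp [mul_comm]
  have h2 : (bitVal A[X] (x i)).natDegree = 0 := by
    cases x i <;> simp [bitVal]
  exact natDegree_mul_le.trans (by omega)

/-- The monomial of any other index contains a variable that vanishes at the indicator point of `α`;
homogeneity produces the factor `s ^ D`. -/
theorem dbEval_indexPoint {c : Fin n → Fin D → Fin r} (hc : Function.Injective c)
    (x : Fin n → Bool) (α : Fin n) (s : A) :
    dbEval c x (fun k => s * indexPoint A c α k) = s ^ D * bitVal A (x α) := by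
  rw [dbEval, Finset.sum_eq_single α]
  · simp [indexPoint, mul_comm]
  · intro i _ hi
    obtain ⟨d, hd⟩ := Function.ne_iff.1 (hc.ne hi)
    rw [Finset.prod_eq_zero (Finset.mem_univ d), mul_zero]
    simp [indexPoint, hd.symm]
  · simp

end DatabasePolynomial

/-! ### Random curves of degree `t` and Hermite interpolation. -/

section Curve

open Polynomial

variable {F K : Type*} [Field F] {ℓ t : ℕ}

/-- The curve `s • e + ∑ u, X ^ (u + 1) • R u` of degree `t` through `s • e`. -/
noncomputable def curve (e : K → F) (s : F) (R : Fin t → K → F) (k : K) : F[X] :=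
  C (s * e k) + ∑ u, C (R u k) * X ^ (u.val + 1)

theorem natDegree_curve_le (e : K → F) (s : F) (R : Fin t → K → F) (k : K) :
    (curve e s R k).natDegree ≤ t := by
  refine natDegree_add_le_of_degree_le ((natDegree_C _).trans_le (Nat.zero_le _)) ?_
  refine natDegree_sum_le_of_forall_le _ _ fun u _ => ?_
  exact (natDegree_C_mul_X_pow_le _ _).trans u.2

theorem eval_zero_curve (e : K → F) (s : F) (R : Fin t → K → F) (k : K) :
    (curve e s R k).eval 0 = s * e k := by
  simp [curve, eval_finsetSum]

/-- The displacement at the points `pts j`, `j ∈ V`, of the curve with coefficients `R` from its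
point at zero. -/
noncomputable def displacement (K : Type*) (t : ℕ) (pts : Fin ℓ → Fˣ) (V : Finset (Fin ℓ)) :
    (Fin t → K → F) →ₗ[F] (V → K → F) where
  toFun R := fun j k => ∑ u, R u k * (pts j : F) ^ (u.val + 1)
  map_add' R R' := by
    ext; simp [add_mul, Finset.sum_add_distrib]
  map_smul' a R := by
    ext; simp [Finset.mul_sum, mul_assoc]

theorem eval_curve (e : K → F) (s : F) (R : Fin t → K → F) (pts : Fin ℓ → Fˣ)
    (V : Finset (Fin ℓ)) (j : V) (k : K) :
    (curve e s R k).eval (pts j : F) = s * e k + displacement K t pts V R j k := by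
  simp [curve, eval_finsetSum, displacement]

/-- The derivative at `a` of the curve with coefficients `R`. -/
noncomputable def velocity (a : F) : (Fin t → K → F) →ₗ[F] (K → F) where
  toFun R := fun k => ∑ u, R u k * (((u.val + 1 : ℕ) : F) * a ^ u.val)
  map_add' R R' := by
    ext; simp [add_mul, Finset.sum_add_distrib]
  map_smul' b R := by
    ext; simp [Finset.mul_sum, mul_assoc]

theorem eval_derivative_curve (e : K → F) (s : F) (R : Fin t → K → F) (a : F) (k : K) :
    (derivative (curve e s R k)).eval a = velocity a R k := by
  simp [curve, eval_finsetSum, velocity]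

theorem displacement_injective {pts : Fin ℓ → Fˣ} (hpts : Function.Injective pts)
    {V : Finset (Fin ℓ)} (hV : V.card = t) :
    Function.Injective (displacement (F := F) K t pts V) := by
  classical
  rw [injective_iff_map_eq_zero]
  intro R hR
  ext u k
  -- The curve through the origin with coefficients `R` has degree at most `t` and `t + 1` zeros:
  -- the parameter zero and the `t` nonzero points of `V`.
  have h0 : curve (fun _ => 0) 0 R k = 0 := by
    refine eq_zero_of_natDegree_lt_card_of_eval_eq_zero' _
      (insert 0 (V.image fun j => (pts j : F))) ?_ ?_
    · intro a ha
      rcases Finset.mem_insert.1 ha with rfl | ha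
      · simp [eval_zero_curve]
      · obtain ⟨j, hj, rfl⟩ := Finset.mem_image.1 ha
        rw [eval_curve (fun _ => 0) 0 R pts V ⟨j, hj⟩ k, hR]
        simp
    · rw [Finset.card_insert_of_notMem (by simp), Finset.card_image_of_injective, hV]
      · exact Nat.lt_succ_of_le (natDegree_curve_le _ _ _ _)
      · exact Units.val_injective.comp hpts
  have h1 := congrArg (fun p => p.coeff (u.val + 1)) h0
  simpa [curve, finsetSum_coeff, coeff_X_pow, Fin.val_inj, coeff_C] using h1

/-- A curve of degree `t` is determined by its point at zero and `t` further points. -/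
noncomputable def displacementEquiv [Fintype K] {pts : Fin ℓ → Fˣ} (hpts : Function.Injective pts)
    {V : Finset (Fin ℓ)} (hV : V.card = t) : (Fin t → K → F) ≃ₗ[F] (V → K → F) :=
  LinearEquiv.ofInjectiveOfFinrankEq (displacement K t pts V) (displacement_injective hpts hV)
    (by simp only [Module.finrank_pi_fintype, Finset.sum_const, Finset.card_univ, Fintype.card_fin,
          Fintype.card_coe, hV])

theorem displacement_symm [Fintype K] {pts : Fin ℓ → Fˣ} (hpts : Function.Injective pts)
    {V : Finset (Fin ℓ)} (hV : V.card = t) (w : V → K → F) :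
    displacement K t pts V ((displacementEquiv hpts hV).symm w) = w :=
  (displacementEquiv hpts hV).apply_symm_apply w

theorem displacement_surjective [Fintype K] {pts : Fin ℓ → Fˣ} (hpts : Function.Injective pts)
    (htℓ : t ≤ ℓ) {V : Finset (Fin ℓ)} (hV : V.card ≤ t) :
    Function.Surjective (displacement (F := F) K t pts V) := by
  classical
  -- Enlarge `V` to exactly `t` servers, where the displacement is bijective, and prescribe zero at
  -- the additional ones.
  obtain ⟨W, hVW, -, hW⟩ := Finset.exists_subsuperset_card_eq (Finset.subset_univ V) hV (by simpa)
  intro w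
  refine ⟨(displacementEquiv hpts hW).symm fun j => if h : j.1 ∈ V then w ⟨j, h⟩ else 0, ?_⟩
  ext j k
  have h := congrFun (congrFun (displacement_symm hpts hW
    fun j => if h : j.1 ∈ V then w ⟨j, h⟩ else 0) ⟨j, hVW j.2⟩) k
  simpa [displacement] using h

/-- A polynomial of degree less than `2 |S|` depends linearly on its values and the values of its
derivative at the points of `S`. -/
theorem exists_hermite_functional {pts : Fin ℓ → Fˣ} (hpts : Function.Injective pts)
    (S : Finset (Fin ℓ)) :
    ∃ φ : (S → F × F) →ₗ[F] F, ∀ g : F[X], g.degree < (2 * S.card : ℕ) →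
      φ (fun j => (g.eval (pts j : F), (derivative g).eval (pts j : F))) = g.eval 0 := by
  let E : degreeLT F (2 * S.card) →ₗ[F] (S → F × F) :=
    { toFun := fun g j => (g.1.eval (pts j : F), (derivative g.1).eval (pts j : F))
      map_add' := by intro g g'; ext <;> simp
      map_smul' := by intro a g; ext <;> simp }
  have hE : Function.Injective E := by
    rw [injective_iff_map_eq_zero]
    intro g hg
    have hdeg := mem_degreeLT.1 g.2
    -- A common zero of `g` and its derivative is a double root in every characteristic, in
    -- particular in characteristic two.
    have hdvd : (∏ j ∈ S, (X - C (pts j : F)) ^ 2) ∣ g.1 := by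
      refine Finset.prod_dvd_of_coprime ?_ ?_
      · intro i _ j _ hij
        refine IsCoprime.pow (isCoprime_X_sub_C_of_isUnit_sub ?_)
        exact (sub_ne_zero.2 fun h => hij (hpts (Units.ext h))).isUnit
      · intro j hj
        have h := congrFun hg ⟨j, hj⟩
        have h1 : g.1.eval (pts j : F) = 0 := congrArg Prod.fst h
        have h2 : (derivative g.1).eval (pts j : F) = 0 := congrArg Prod.snd h
        obtain ⟨p, hp⟩ := dvd_iff_isRoot.2 h1
        rw [hp] at h2 ⊢
        have h3 : p.eval (pts j : F) = 0 := by simpa using h2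
        obtain ⟨p', rfl⟩ := dvd_iff_isRoot.2 h3
        exact ⟨p', by ring⟩
    by_contra hne
    have hne' : g.1 ≠ 0 := fun h => hne (Subtype.ext h)
    have h := degree_le_of_dvd hdvd hne'
    rw [degree_prod] at h
    simp only [degree_pow, degree_X_sub_C, Finset.sum_const, nsmul_eq_mul, mul_one] at h
    refine absurd h (not_le.2 (hdeg.trans_eq ?_))
    push_cast
    ring
  -- A linear left inverse recovers the polynomial from its Hermite data; the functional then
  -- evaluates it at zero.
  obtain ⟨L, hL⟩ := E.exists_leftInverse_of_injective (LinearMap.ker_eq_bot.2 hE)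
  refine ⟨(leval 0) ∘ₗ (degreeLT F (2 * S.card)).subtype ∘ₗ L, fun g hg => ?_⟩
  have h := LinearMap.congr_fun hL ⟨g, mem_degreeLT.2 hg⟩
  exact congrArg (fun p => (p.1 : F[X]).eval 0) h

end Curve

/-! ### Explained blocks and the effect of wrong answers. -/

section Reconstruction

open Polynomial

variable {F : Type*} [Field F] {ℓ t n m D r : ℕ}

/-- The answer of an honest server to the query `z`: for each bit position, the value and the
gradient of the database polynomial at `z`. -/
def honestAnswer (c : Fin n → Fin D → Fin r) (x : Database n m) (z : Fin D × Fin r → F) :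
    Fin m → F × (Fin D × Fin r → F) :=
  fun i => (dbEval c (fun a => x a i) z, dbGrad c (fun a => x a i) z)

/-- The answers of the servers in `S` are explained by the block `y`: for each bit position they
are the values and the derivatives of a polynomial of degree less than `2 |S|` whose value at zero
is `s ^ D` times the bit of `y`. -/
def Explains {K : Type*} [Fintype K] (D : ℕ) (pts : Fin ℓ → Fˣ) (S : Finset (Fin ℓ)) (s : F)
    (vel : Fin ℓ → K → F) (a : Fin ℓ → Fin m → F × (K → F)) (y : Bits m) : Prop :=
  ∀ i, ∃ g : F[X], g.degree < (2 * S.card : ℕ) ∧ g.eval 0 = s ^ D * bitVal F (y i) ∧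
    ∀ j ∈ S, g.eval (pts j : F) = (a j i).1 ∧
      (derivative g).eval (pts j : F) = ∑ k, (a j i).2 k * vel j k

/-- The point of the curve that is sent to server `j`. -/
noncomputable def queryPoint (c : Fin n → Fin D → Fin r) (pts : Fin ℓ → Fˣ) (α : Fin n) (s : F)
    (R : Fin t → Fin D × Fin r → F) (j : Fin ℓ) : Fin D × Fin r → F :=
  fun k => (curve (indexPoint F c α) s R k).eval (pts j : F)

/-- The restriction of the database polynomial to the query curve. -/
theorem exists_restriction {c : Fin n → Fin D → Fin r} (hc : Function.Injective c)
    (pts : Fin ℓ → Fˣ) (x : Database n m) (α : Fin n) (s : F) (R : Fin t → Fin D × Fin r → F)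
    {N : ℕ} (hN : t * D < N) (i : Fin m) :
    ∃ f : F[X], f.degree < N ∧ f.eval 0 = s ^ D * bitVal F (x α i) ∧
      ∀ j, f.eval (pts j : F) = (honestAnswer c x (queryPoint c pts α s R j) i).1 ∧
        (derivative f).eval (pts j : F) =
          ∑ k, (honestAnswer c x (queryPoint c pts α s R j) i).2 k * velocity (pts j : F) R k := by
  refine ⟨dbEval c (fun a => x a i) (curve (indexPoint F c α) s R), ?_, ?_, fun j => ⟨?_, ?_⟩⟩
  · exact degree_le_natDegree.trans_lt (Nat.cast_lt.2
      ((natDegree_dbEval_le _ _ _ t (natDegree_curve_le _ _ _)).trans_lt hN))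
  · rw [← coe_evalRingHom, map_dbEval, ← dbEval_indexPoint hc (fun a => x a i)]
    simp only [coe_evalRingHom, eval_zero_curve]
  · rw [← coe_evalRingHom, map_dbEval]
    rfl
  · rw [derivative_dbEval, eval_finsetSum]
    refine Finset.sum_congr rfl fun k _ => ?_
    rw [eval_mul, eval_derivative_curve, ← coe_evalRingHom, map_dbGrad]
    rfl

/-- The number of scalars `s` for which an affine function of `s` hits `0` or a multiple of `s ^ D`
is at most `D + 1`. -/
theorem card_affine_hits_le {A B σ : F} (hAB : A ≠ 0 ∨ B ≠ 0) (hσ : σ ≠ 0) (hD : 2 ≤ D)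
    (Z : Finset Fˣ) (hZ : ∀ s ∈ Z, A + s * B = 0 ∨ A + s * B = (s : F) ^ D * σ) :
    Z.card ≤ D + 1 := by
  classical
  set p : F[X] := C A + C B * X with hp
  set q : F[X] := p - C σ * X ^ D with hq
  have hp0 : p ≠ 0 := by
    intro h
    rcases hAB with hA | hB
    · exact hA (by simpa [hp] using congrArg (fun p => p.coeff 0) h)
    · exact hB (by simpa [hp, coeff_C] using congrArg (fun p => p.coeff 1) h)
  have hpd : p.natDegree ≤ 1 := by rw [hp, add_comm]; exact natDegree_linear_le
  have hq0 : q ≠ 0 := by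
    intro h
    -- Here `D ≥ 2` enters: the affine part cannot cancel the coefficient `-σ` of `X ^ D`.
    have h1 := congrArg (fun p => p.coeff D) h
    simp only [hq, coeff_sub, coeff_eq_zero_of_natDegree_lt (show p.natDegree < D by omega),
      coeff_C_mul, coeff_X_pow, coeff_zero] at h1
    simp [hσ] at h1
  have hqd : q.natDegree ≤ D :=
    (natDegree_sub_le _ _).trans (max_le (by omega) (natDegree_C_mul_X_pow_le _ _))
  have hpq : p * q ≠ 0 := mul_ne_zero hp0 hq0
  rw [← Finset.card_image_of_injective Z Units.val_injective]
  calc (Z.image Units.val).card ≤ (p * q).roots.toFinset.card := by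
        refine Finset.card_le_card fun a ha => ?_
        obtain ⟨s, hs, rfl⟩ := Finset.mem_image.1 ha
        rw [Multiset.mem_toFinset, mem_roots hpq, IsRoot, eval_mul, mul_eq_zero]
        refine (hZ s hs).imp (fun h => ?_) fun h => ?_
        · simp only [hp, eval_add, eval_C, eval_mul, eval_X]
          linear_combination h
        · simp only [hq, hp, eval_add, eval_C, eval_mul, eval_X, eval_sub, eval_pow]
          linear_combination h
    _ ≤ (p * q).natDegree := (Multiset.toFinset_card_le _).trans (card_roots' _)
    _ ≤ D + 1 := natDegree_mul_le.trans (by omega)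

/-- The coefficients of the query curve through the points `w` at the servers in `W`. -/
noncomputable def curveThrough {c : Fin n → Fin D → Fin r} {pts : Fin ℓ → Fˣ}
    (hpts : Function.Injective pts) {W : Finset (Fin ℓ)} (hW : W.card = t) (α : Fin n)
    (w : W → Fin D × Fin r → F) (s : F) : Fin t → Fin D × Fin r → F :=
  (displacementEquiv hpts hW).symm fun j k => w j k - s * indexPoint F c α k

theorem queryPoint_curveThrough {c : Fin n → Fin D → Fin r} {pts : Fin ℓ → Fˣ}
    (hpts : Function.Injective pts) {W : Finset (Fin ℓ)} (hW : W.card = t) (α : Fin n)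
    (w : W → Fin D × Fin r → F) (s : F) (j : W) :
    queryPoint c pts α s (curveThrough (c := c) hpts hW α w s) j = w j := by
  ext k
  rw [queryPoint, eval_curve _ _ _ _ W, curveThrough, displacement_symm]
  ring

/-- Once the queries `w` are fixed, the curve, and with it every velocity, is affine in the hidden
scalar `s`. -/
theorem curveThrough_eq {c : Fin n → Fin D → Fin r} {pts : Fin ℓ → Fˣ}
    (hpts : Function.Injective pts) {W : Finset (Fin ℓ)} (hW : W.card = t) (α : Fin n)
    (w : W → Fin D × Fin r → F) (s : F) :
    curveThrough (c := c) hpts hW α w s = (displacementEquiv hpts hW).symm w -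
      s • (displacementEquiv hpts hW).symm fun _ => indexPoint F c α := by
  rw [← map_smul, ← map_sub]
  rfl

/-- If the queries to the servers in `W` are fixed, then wrong answers of servers in `V ⊆ W` that
do not depend on the scalar `s` are explained by a wrong block for at most `D + 1` scalars. -/
theorem card_wrongly_explained_le {c : Fin n → Fin D → Fin r} (hc : Function.Injective c)
    {pts : Fin ℓ → Fˣ} (hpts : Function.Injective pts) (hD : 2 ≤ D)
    {V W S : Finset (Fin ℓ)} (hVW : V ⊆ W) (hW : W.card = t) (hS : t * D < 2 * S.card)
    (x : Database n m) (α : Fin n) (w : W → Fin D × Fin r → F)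
    (a' : V → Fin m → F × (Fin D × Fin r → F)) (Z : Finset Fˣ)
    (hZ : ∀ s ∈ Z, ∃ y, y ≠ x α ∧ Explains D pts S (s : F)
      (fun j => velocity (pts j : F) (curveThrough (c := c) hpts hW α w s))
      (fun j => if h : j ∈ V then a' ⟨j, h⟩ else
        honestAnswer c x (queryPoint c pts α s (curveThrough (c := c) hpts hW α w s) j)) y) :
    Z.card ≤ D + 1 := by
  classical
  obtain ⟨φ, hφ⟩ := exists_hermite_functional hpts S
  -- `dev` does not involve `s`. Pairing its gradient part with the velocity makes the error in the
  -- Hermite data affine in `s`: `A` is the constant part and `B` the coefficient of `s`.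
  let dev (i : Fin m) (j : Fin ℓ) (h : j ∈ V) : F × (Fin D × Fin r → F) :=
    a' ⟨j, h⟩ i - honestAnswer c x (w ⟨j, hVW h⟩) i
  let A (i : Fin m) : S → F × F := fun j => if h : j.1 ∈ V then
    ((dev i j h).1, ∑ k, (dev i j h).2 k *
      velocity (pts j : F) ((displacementEquiv hpts hW).symm w) k) else 0
  let B (i : Fin m) : S → F × F := fun j => if h : j.1 ∈ V then
    (0, -∑ k, (dev i j h).2 k *
      velocity (pts j : F) ((displacementEquiv hpts hW).symm fun _ => indexPoint F c α) k) else 0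
  have key : ∀ (s : F) (y : Bits m), Explains D pts S s
      (fun j => velocity (pts j : F) (curveThrough (c := c) hpts hW α w s))
      (fun j => if h : j ∈ V then a' ⟨j, h⟩ else
        honestAnswer c x (queryPoint c pts α s (curveThrough (c := c) hpts hW α w s) j)) y →
      ∀ i, φ (A i) + s * φ (B i) = s ^ D * (bitVal F (y i) - bitVal F (x α i)) := by
    intro s y hy i
    obtain ⟨g, hg, hg0, hgS⟩ := hy i
    obtain ⟨f, hf, hf0, hfS⟩ :=
      exists_restriction hc pts x α s (curveThrough (c := c) hpts hW α w s) hS i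
    -- The explaining `g` is compared with the true restriction `f`; their Hermite data differ only
    -- at servers in `V`.
    have hd : (g - f).degree < (2 * S.card : ℕ) := (degree_sub_le _ _).trans_lt (max_lt hg hf)
    have h := hφ _ hd
    rw [eval_sub, hg0, hf0, ← mul_sub] at h
    rw [← h, ← smul_eq_mul, ← map_smul, ← map_add]
    congr 1
    ext1 j
    obtain ⟨hg1, hg2⟩ := hgS j j.2
    obtain ⟨hf1, hf2⟩ := hfS j
    simp only [derivative_sub, eval_sub, hg1, hg2, hf1, hf2, Pi.add_apply, Pi.smul_apply, A, B]
    by_cases hj : j.1 ∈ V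
    · have hq := queryPoint_curveThrough (c := c) hpts hW α w s ⟨j, hVW hj⟩
      simp only at hq
      simp only [hj, dif_pos, hq]
      refine Prod.ext (by simp [dev]) ?_
      rw [← Finset.sum_sub_distrib]
      simp only [Prod.snd_add, Prod.smul_snd, smul_eq_mul, mul_neg, ← sub_eq_add_neg,
        Finset.mul_sum]
      rw [← Finset.sum_sub_distrib]
      refine Finset.sum_congr rfl fun k _ => ?_
      simp only [curveThrough_eq, map_sub, map_smul, Pi.sub_apply, Pi.smul_apply, smul_eq_mul, dev,
        Prod.snd_sub]
      ring
    · simp [hj, ← Prod.zero_eq_mk]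
  by_cases hAB : ∃ i, φ (A i) ≠ 0 ∨ φ (B i) ≠ 0
  · obtain ⟨i, hi⟩ := hAB
    -- The claimed bit is either the true one, giving `0`, or its negation, giving `s ^ D * σ`; so
    -- one `σ` serves all blocks `y`.
    refine card_affine_hits_le (σ := bitVal F (!x α i) - bitVal F (x α i)) hi ?_ hD Z ?_
    · cases x α i <;> simp [bitVal]
    · intro s hs
      obtain ⟨y, -, hy⟩ := hZ s hs
      rw [key s y hy i]
      cases y i <;> cases x α i <;> simp
  -- If no position is affected, `s ^ D` times each bit difference is zero, so only the true block
  -- is explained.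
  · push Not at hAB
    rw [Finset.card_eq_zero.2 (Finset.eq_empty_of_forall_notMem fun s hs => ?_)]
    · exact Nat.zero_le _
    · obtain ⟨y, hne, hy⟩ := hZ s hs
      refine hne (funext fun i => ?_)
      have h := key s y hy i
      rw [(hAB i).1, (hAB i).2, mul_zero, zero_add, eq_comm, mul_eq_zero] at h
      have h' := h.resolve_left (pow_ne_zero _ s.ne_zero)
      revert h'
      cases y i <;> cases x α i <;> simp [bitVal]

end Reconstruction

/-! ### Uniform distributions and conditioning. -/

section Uniform

theorem PMF.uniformOfFintype_map_equiv {X Y : Type*} [Fintype X] [Nonempty X] [Fintype Y]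
    [Nonempty Y] (e : X ≃ Y) : (PMF.uniformOfFintype X).map e = PMF.uniformOfFintype Y := by
  classical
  ext y
  rw [PMF.map_apply, tsum_eq_single (e.symm y)]
  · simp [Fintype.card_congr e]
  · intro x hx
    rw [if_neg]
    rintro rfl
    simp at hx

theorem PMF.uniformOfFintype_prod (X Y : Type*) [Fintype X] [Nonempty X] [Fintype Y]
    [Nonempty Y] : PMF.uniformOfFintype (X × Y) =
      (PMF.uniformOfFintype Y).bind fun y => (PMF.uniformOfFintype X).map fun x => (x, y) := by
  classical
  ext ⟨x, y⟩
  rw [PMF.bind_apply, tsum_eq_single y]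
  · rw [PMF.map_apply, tsum_eq_single x]
    · simp [ENNReal.mul_inv, mul_comm]
    · intro x' hx'
      rw [if_neg]
      rintro ⟨⟩
      exact hx' rfl
  · intro y' hy'
    rw [PMF.map_apply, ENNReal.tsum_eq_zero.2, mul_zero]
    intro x'
    rw [if_neg]
    rintro ⟨⟩
    exact hy' rfl

theorem PMF.uniformOfFintype_map_of_surjective {G H : Type*} [AddGroup G] [AddGroup H] [Fintype G]
    [Fintype H] (f : G →+ H) (hf : Function.Surjective f) :
    (PMF.uniformOfFintype G).map f = PMF.uniformOfFintype H := by
  classical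
  have hconst : ∀ y y' : H, (PMF.uniformOfFintype G).map f y = (PMF.uniformOfFintype G).map f y' := by
    intro y y'
    obtain ⟨g, hg⟩ := hf (y' - y)
    -- Translation by a preimage `g` of `y' - y` carries the fibre over `y` to the fibre over `y'`.
    rw [PMF.map_apply, PMF.map_apply, ← (Equiv.addLeft g).tsum_eq (fun a => ite (y' = f a) _ _)]
    refine tsum_congr fun a => ?_
    have : y' = f (g + a) ↔ y = f a := by
      rw [map_add, hg]
      exact ⟨fun h => add_left_cancel ((sub_add_cancel y' y).trans h),
        fun h => by rw [← h, sub_add_cancel]⟩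
    simp only [Equiv.coe_addLeft, this, PMF.uniformOfFintype_apply]
  ext y
  have h := ((PMF.uniformOfFintype G).map f).tsum_coe
  rw [tsum_fintype, Finset.sum_congr rfl fun y' _ => hconst y' y] at h
  rw [PMF.uniformOfFintype_apply]
  refine ENNReal.eq_inv_of_mul_eq_one_left ?_
  simpa [mul_comm] using h

theorem PMF.toOuterMeasure_bind_le {X Y : Type*} (p : PMF X) (f : X → PMF Y) (s : Set Y)
    {c : ENNReal} (h : ∀ a, (f a).toOuterMeasure s ≤ c) : (p.bind f).toOuterMeasure s ≤ c := by
  rw [PMF.toOuterMeasure_bind_apply]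
  calc ∑' a, p a * (f a).toOuterMeasure s ≤ ∑' a, p a * c :=
        ENNReal.tsum_le_tsum fun a => mul_le_mul_right (h a) _
    _ = c := by rw [ENNReal.tsum_mul_right, p.tsum_coe, one_mul]

end Uniform

/-! ### The scheme and its correctness. -/

/-- The parameters of a scheme that evaluates the database polynomials on curves of degree `t`: an
encoding of the indices by monomials of degree `D`, and for each security parameter a field of
characteristic two with a nonzero evaluation point for each server. -/
structure CurveParams (ℓ t D : ℕ) where
  /-- number of choices for each of the `D` factors of a monomial -/
  r : ℕ → ℕ
  /-- encoding of the indices -/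
  code : (n : ℕ) → Fin n → Fin D → Fin (r n)
  code_injective : ∀ n, Function.Injective (code n)
  /-- the field -/
  F : ℕ → Type
  [field : ∀ κ, Field (F κ)]
  [fintype : ∀ κ, Fintype (F κ)]
  [decidableEq : ∀ κ, DecidableEq (F κ)]
  /-- number of bits of a field element -/
  b : ℕ → ℕ
  card_F : ∀ κ, Fintype.card (F κ) = 2 ^ b κ
  /-- evaluation points of the servers -/
  pts : (κ : ℕ) → Fin ℓ → (F κ)ˣ
  pts_injective : ∀ κ, Function.Injective (pts κ)

namespace CurveParams

attribute [instance] CurveParams.field CurveParams.fintype CurveParams.decidableEq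

variable {ℓ t D : ℕ} (Q : CurveParams ℓ t D)

/-- Points at which the database polynomials are evaluated. -/
abbrev Point (κ n : ℕ) : Type := Fin D × Fin (Q.r n) → Q.F κ

/-- The coins of the client: the scalar at the point zero and the coefficients of the curve. -/
abbrev Seed (κ n : ℕ) : Type := (Q.F κ)ˣ × (Fin t → Q.Point κ n)

/-- Encoding of points by bit strings. -/
noncomputable def encodeQuery (κ n : ℕ) : Q.Point κ n ≃ Bits (Q.b κ * (D * Q.r n)) :=
  Fintype.equivOfCardEq (by simp [Q.card_F, pow_mul])

/-- Encoding of answers by bit strings. -/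
noncomputable def encodeAnswer (κ n m : ℕ) :
    (Fin m → Q.F κ × Q.Point κ n) ≃ Bits (m * (Q.b κ * (D * Q.r n + 1))) :=
  Fintype.equivOfCardEq (by simp [Q.card_F, pow_mul, pow_succ, mul_comm m, mul_comm (2 ^ Q.b κ)])

/-- The block `y` is explained by some `ℓ - t` of the answers. -/
def Plausible {κ n m : ℕ} (s : Q.F κ) (vel : Fin ℓ → Q.Point κ n)
    (a : Fin ℓ → Fin m → Q.F κ × Q.Point κ n) (y : Bits m) : Prop :=
  ∃ S : Finset (Fin ℓ), S.card = ℓ - t ∧ Explains D (Q.pts κ) S s vel a y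

open Classical in
/-- The scheme in which the client outputs a plausible block. It never rejects. -/
noncomputable def scheme : APIRScheme ℓ where
  qlen κ n := Q.b κ * (D * Q.r n)
  alen κ n m := m * (Q.b κ * (D * Q.r n + 1))
  Aux κ n := (Q.F κ)ˣ × (Fin ℓ → Q.Point κ n)
  que κ n α := (PMF.uniformOfFintype (Q.Seed κ n)).map fun p =>
    (fun j => Q.encodeQuery κ n (queryPoint (Q.code n) (Q.pts κ) α p.1 p.2 j),
      (p.1, fun j => velocity (Q.pts κ j : Q.F κ) p.2))
  ans κ n m x q := Q.encodeAnswer κ n m (honestAnswer (Q.code n) x ((Q.encodeQuery κ n).symm q))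
  recon κ n m a aux := some <|
    if h : ∃ y, Q.Plausible (aux.1 : Q.F κ) aux.2 (fun j => (Q.encodeAnswer κ n m).symm (a j)) y
    then h.choose else fun _ => false

/-- The queries and the auxiliary information that the client computes from its coins. -/
noncomputable def clientMessage {κ n : ℕ} (α : Fin n) (p : Q.Seed κ n) :
    (Fin ℓ → Bits (Q.scheme.qlen κ n)) × Q.scheme.Aux κ n :=
  (fun j => Q.encodeQuery κ n (queryPoint (Q.code n) (Q.pts κ) α p.1 p.2 j),
    (p.1, fun j => velocity (Q.pts κ j : Q.F κ) p.2))

theorem scheme_que {κ n : ℕ} (α : Fin n) : Q.scheme.que κ n α =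
    (PMF.uniformOfFintype (Q.Seed κ n)).map (Q.clientMessage α) :=
  rfl

/-- The client accepts some block that is plausible if there is one. -/
theorem recon_spec {κ n m : ℕ} (a : Fin ℓ → Bits (Q.scheme.alen κ n m)) (aux : Q.scheme.Aux κ n)
    {y₀ : Bits m} (h : Q.Plausible (aux.1 : Q.F κ) aux.2
      (fun j => (Q.encodeAnswer κ n m).symm (a j)) y₀) :
    ∃ y, Q.scheme.recon κ n m a aux = some y ∧ Q.Plausible (aux.1 : Q.F κ) aux.2
      (fun j => (Q.encodeAnswer κ n m).symm (a j)) y := by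
  have h' : ∃ y, Q.Plausible (aux.1 : Q.F κ) aux.2
      (fun j => (Q.encodeAnswer κ n m).symm (a j)) y := ⟨y₀, h⟩
  exact ⟨h'.choose, congrArg some (dif_pos h'), h'.choose_spec⟩

/-- The answers as decoded by the client if the servers in `V` send `a'`. -/
theorem decode_answers {κ n m : ℕ} (V : Finset (Fin ℓ)) (x : Database n m)
    (z : Fin ℓ → Q.Point κ n) (a' : Q.scheme.AnswersOf V κ n m) :
    (fun j => (Q.encodeAnswer κ n m).symm (if h : j ∈ V then a' ⟨j, h⟩ else
      Q.scheme.ans κ n m x (Q.encodeQuery κ n (z j)))) =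
    fun j => if h : j ∈ V then (Q.encodeAnswer κ n m).symm (a' ⟨j, h⟩) else
      honestAnswer (Q.code n) x (z j) := by
  funext j
  by_cases h : j ∈ V
  · simp [h]
  · simp [h, scheme]

/-- At least `ℓ - t` servers lie outside `V`, and the restriction of the database polynomial
explains their answers, whatever the servers in `V` send. -/
theorem plausible_of_honest (htℓ : t ≤ ℓ) (hD : t * D < 2 * (ℓ - t)) {κ n m : ℕ}
    {V : Finset (Fin ℓ)} (hV : V.card ≤ t) (x : Database n m) (α : Fin n) (s : Q.F κ)
    (R : Fin t → Q.Point κ n) (a : Fin ℓ → Fin m → Q.F κ × Q.Point κ n)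
    (ha : ∀ j ∉ V, a j = honestAnswer (Q.code n) x (queryPoint (Q.code n) (Q.pts κ) α s R j)) :
    Q.Plausible s (fun j => velocity (Q.pts κ j : Q.F κ) R) a (x α) := by
  have hcard : ℓ - t ≤ (Vᶜ).card := by
    rw [Finset.card_compl, Fintype.card_fin]
    omega
  obtain ⟨S, hSV, hS⟩ := Finset.exists_subset_card_eq hcard
  refine ⟨S, hS, fun i => ?_⟩
  obtain ⟨f, hf, hf0, hfS⟩ := exists_restriction (Q.code_injective n) (Q.pts κ) x α s R
    (hS.symm ▸ hD : t * D < 2 * S.card) i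
  refine ⟨f, hf, hf0, fun j hj => ?_⟩
  rw [ha j (Finset.mem_compl.1 (hSV hj))]
  exact hfS j

/-- Equal Hermite data on `S` force equal values at zero, and `s ^ D` can be cancelled because `s`
is a unit. -/
theorem plausible_honest_unique (hD : t * D < 2 * (ℓ - t)) {κ n m : ℕ}
    (x : Database n m) (α : Fin n) (s : (Q.F κ)ˣ) (R : Fin t → Q.Point κ n) {y : Bits m}
    (hy : Q.Plausible (s : Q.F κ) (fun j => velocity (Q.pts κ j : Q.F κ) R)
      (fun j => honestAnswer (Q.code n) x (queryPoint (Q.code n) (Q.pts κ) α (s : Q.F κ) R j)) y) :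
    y = x α := by
  obtain ⟨S, hS, hy⟩ := hy
  funext i
  obtain ⟨g, hg, hg0, hgS⟩ := hy i
  obtain ⟨f, hf, hf0, hfS⟩ := exists_restriction (Q.code_injective n) (Q.pts κ) x α (s : Q.F κ) R
    (hS.symm ▸ hD : t * D < 2 * S.card) i
  obtain ⟨φ, hφ⟩ := exists_hermite_functional (Q.pts_injective κ) S
  have h : g.eval 0 = f.eval 0 := by
    rw [← hφ g hg, ← hφ f hf]
    congr 1
    ext1 j
    rw [(hgS j j.2).1, (hgS j j.2).2, (hfS j).1, (hfS j).2]
  rw [hg0, hf0] at h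
  have h' := mul_left_cancel₀ (pow_ne_zero _ s.ne_zero) h
  revert h'
  cases y i <;> cases x α i <;> simp [bitVal]

theorem scheme_correct (htℓ : t ≤ ℓ) (hD : t * D < 2 * (ℓ - t)) : Q.scheme.Correct := by
  intro κ n m x α
  rw [scheme_que, PMF.map_comp]
  suffices h : ∀ p : Q.Seed κ n, Q.scheme.recon κ n m
      (fun j => Q.scheme.ans κ n m x
        (Q.encodeQuery κ n (queryPoint (Q.code n) (Q.pts κ) α (p.1 : Q.F κ) p.2 j)))
      (p.1, fun j => velocity (Q.pts κ j : Q.F κ) p.2) = some (x α) by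
    have h' : (PMF.uniformOfFintype (Q.Seed κ n)).map (fun _ => some (x α)) (some (x α)) = 1 := by
      rw [show (fun _ : Q.Seed κ n => some (x α)) = Function.const _ (some (x α)) from rfl,
        PMF.map_const, PMF.pure_apply_self]
    exact (congrArg (fun f => (PMF.uniformOfFintype (Q.Seed κ n)).map f (some (x α)))
      (funext h)).trans h'
  intro p
  have hans : (fun j => (Q.encodeAnswer κ n m).symm (Q.scheme.ans κ n m x
      (Q.encodeQuery κ n (queryPoint (Q.code n) (Q.pts κ) α (p.1 : Q.F κ) p.2 j)))) =
      fun j => honestAnswer (Q.code n) x (queryPoint (Q.code n) (Q.pts κ) α (p.1 : Q.F κ) p.2 j) :=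
    funext fun j => by simp [scheme]
  have hpl := Q.plausible_of_honest htℓ hD (V := ∅) (by simp) x α (p.1 : Q.F κ) p.2
    (fun j => honestAnswer (Q.code n) x (queryPoint (Q.code n) (Q.pts κ) α (p.1 : Q.F κ) p.2 j))
    fun j _ => rfl
  obtain ⟨y, hy, hy'⟩ := Q.recon_spec _ (p.1, fun j => velocity (Q.pts κ j : Q.F κ) p.2)
    (hans ▸ hpl)
  rw [hans] at hy'
  rw [hy, Q.plausible_honest_unique hD x α p.1 p.2 hy']

/-! ### Integrity and uniformity of the queries. -/

/-- Reparametrization of the coins by the queries to `t` servers. -/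
noncomputable def seedEquiv {κ n : ℕ} {W : Finset (Fin ℓ)} (hW : W.card = t) (α : Fin n) :
    (Q.F κ)ˣ × (W → Q.Point κ n) ≃ Q.Seed κ n :=
  Equiv.prodShear (Equiv.refl _) fun s =>
    (Equiv.subRight (fun (_ : W) k => (s : Q.F κ) * indexPoint (Q.F κ) (Q.code n) α k)).trans
      (displacementEquiv (Q.pts_injective κ) hW).symm.toEquiv

/-- The queries to `W` may be drawn first and the scalar afterwards, so the view of `W` is
independent of `s`. -/
theorem uniform_seed {κ n : ℕ} {W : Finset (Fin ℓ)} (hW : W.card = t) (α : Fin n) :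
    PMF.uniformOfFintype (Q.Seed κ n) =
      (PMF.uniformOfFintype (W → Q.Point κ n)).bind fun w =>
        (PMF.uniformOfFintype (Q.F κ)ˣ).map fun s : (Q.F κ)ˣ =>
          (s, curveThrough (c := Q.code n) (Q.pts_injective κ) hW α w (s : Q.F κ)) := by
  rw [← PMF.uniformOfFintype_map_equiv (Q.seedEquiv hW α), PMF.uniformOfFintype_prod, PMF.map_bind]
  simp only [PMF.map_comp]
  rfl

theorem card_wrong_output_le (htℓ : t ≤ ℓ) (hD : t * D < 2 * (ℓ - t)) (hD2 : 2 ≤ D) {κ n m : ℕ}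
    {V W : Finset (Fin ℓ)} (hVW : V ⊆ W) (hW : W.card = t) (x : Database n m) (α : Fin n)
    (w : W → Q.Point κ n) (a' : Q.scheme.AnswersOf V κ n m) (Z : Finset (Q.F κ)ˣ)
    (hZ : ∀ s ∈ Z, Q.scheme.output V x
      (fun j => Q.encodeQuery κ n (queryPoint (Q.code n) (Q.pts κ) α (s : Q.F κ)
        (curveThrough (c := Q.code n) (Q.pts_injective κ) hW α w (s : Q.F κ)) j))
      (s, fun j => velocity (Q.pts κ j : Q.F κ)
        (curveThrough (c := Q.code n) (Q.pts_injective κ) hW α w (s : Q.F κ))) a' ≠ some (x α)) :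
    Z.card ≤ 2 ^ ℓ * (D + 1) := by
  classical
  let bad (S : Finset (Fin ℓ)) (s : (Q.F κ)ˣ) : Prop := S.card = ℓ - t ∧ ∃ y, y ≠ x α ∧
    Explains D (Q.pts κ) S (s : Q.F κ)
      (fun j => velocity (Q.pts κ j : Q.F κ)
        (curveThrough (c := Q.code n) (Q.pts_injective κ) hW α w (s : Q.F κ)))
      (fun j => if h : j ∈ V then (Q.encodeAnswer κ n m).symm (a' ⟨j, h⟩) else
        honestAnswer (Q.code n) x (queryPoint (Q.code n) (Q.pts κ) α (s : Q.F κ)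
          (curveThrough (c := Q.code n) (Q.pts_injective κ) hW α w (s : Q.F κ)) j)) y
  -- Some block is plausible, so the fallback output is never used, and a wrong output is explained
  -- by some `S`.
  have hcover : Z ⊆ (Finset.univ : Finset (Finset (Fin ℓ))).biUnion fun S => Z.filter (bad S) := by
    intro s hs
    set R := curveThrough (c := Q.code n) (Q.pts_injective κ) hW α w (s : Q.F κ) with hR
    have hdec := Q.decode_answers V x (queryPoint (Q.code n) (Q.pts κ) α (s : Q.F κ) R) a'
    have hpl := Q.plausible_of_honest htℓ hD ((Finset.card_le_card hVW).trans hW.le) x α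
      (s : Q.F κ) R
      (fun j => if h : j ∈ V then (Q.encodeAnswer κ n m).symm (a' ⟨j, h⟩) else
        honestAnswer (Q.code n) x (queryPoint (Q.code n) (Q.pts κ) α (s : Q.F κ) R j))
      fun j hj => dif_neg hj
    obtain ⟨y, hy, hy'⟩ := Q.recon_spec _ (s, fun j => velocity (Q.pts κ j : Q.F κ) R)
      (hdec ▸ hpl)
    have hne : y ≠ x α := by
      rintro rfl
      exact hZ s hs hy
    obtain ⟨S, hS, hexp⟩ := hy'
    rw [hdec] at hexp
    simp only [Finset.mem_biUnion, Finset.mem_univ, true_and, Finset.mem_filter]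
    exact ⟨S, hs, hS, y, hne, hexp⟩
  calc Z.card ≤ _ := Finset.card_le_card hcover
    _ ≤ (Finset.univ : Finset (Finset (Fin ℓ))).card * (D + 1) := by
        refine Finset.card_biUnion_le_card_mul _ _ _ fun S _ => ?_
        by_cases hS : S.card = ℓ - t
        · exact card_wrongly_explained_le (Q.code_injective n) (Q.pts_injective κ) hD2 hVW hW
            (hS.symm ▸ hD) x α w (fun j => (Q.encodeAnswer κ n m).symm (a' j)) _
            fun s hs => (Finset.mem_filter.1 hs).2.2
        · rw [Finset.filter_false_of_mem fun s _ h => hS h.1]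
          simp
    _ = 2 ^ ℓ * (D + 1) := by simp

theorem scheme_integrity (htℓ : t ≤ ℓ) (hD : t * D < 2 * (ℓ - t)) (hD2 : 2 ≤ D) {ε : ℕ → ℝ}
    (hε : ∀ κ, (2 ^ ℓ * (D + 1) : ℝ) ≤ ε κ * (2 ^ Q.b κ - 1)) : Q.scheme.Integrity t ε := by
  classical
  intro κ n m x α V hV A
  obtain ⟨W, hVW, -, hW⟩ := Finset.exists_subsuperset_card_eq (Finset.subset_univ V) hV (by simpa)
  let R (w : W → Q.Point κ n) (s : (Q.F κ)ˣ) :=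
    curveThrough (c := Q.code n) (Q.pts_injective κ) hW α w (s : Q.F κ)
  let out (w : W → Q.Point κ n) (a' : Q.scheme.AnswersOf V κ n m) (s : (Q.F κ)ˣ) :=
    Q.scheme.output V x
      (fun j => Q.encodeQuery κ n (queryPoint (Q.code n) (Q.pts κ) α (s : Q.F κ) (R w s) j))
      (s, fun j => velocity (Q.pts κ j : Q.F κ) (R w s)) a'
  have hexp : Q.scheme.integrityExp V A x α =
      (PMF.uniformOfFintype (W → Q.Point κ n)).bind fun w =>
        (A x fun j : V => Q.encodeQuery κ n (w ⟨j, hVW j.2⟩)).bind fun a' =>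
          (PMF.uniformOfFintype (Q.F κ)ˣ).map (out w a') := by
    rw [APIRScheme.integrityExp,
      scheme_que,
      Q.uniform_seed hW α, PMF.map_bind, PMF.bind_bind]
    congr 1
    funext w
    rw [PMF.map_comp, PMF.bind_map]
    simp only [← PMF.bind_pure_comp]
    -- The answers depend on `w` only, so they can be drawn before `s`.
    rw [PMF.bind_comm]
    congr 1
    funext s
    have hq : (fun j : V => Q.encodeQuery κ n (queryPoint (Q.code n) (Q.pts κ) α (s : Q.F κ)
        (R w s) j)) = fun j : V => Q.encodeQuery κ n (w ⟨j, hVW j.2⟩) :=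
      funext fun j => congrArg _ (queryPoint_curveThrough (c := Q.code n) (Q.pts_injective κ) hW α w
        (s : Q.F κ) ⟨j, hVW j.2⟩)
    rw [← hq]
    rfl
  rw [hexp]
  refine PMF.toOuterMeasure_bind_le _ _ _ fun w => PMF.toOuterMeasure_bind_le _ _ _ fun a' => ?_
  rw [PMF.toOuterMeasure_map_apply, PMF.toOuterMeasure_uniformOfFintype_apply]
  have hcard := Q.card_wrong_output_le htℓ hD hD2 hVW hW x α w a'
    (out w a' ⁻¹' {y | y ≠ some (x α) ∧ y ≠ none}).toFinset
    fun s hs => (Set.mem_toFinset.1 hs).1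
  rw [Set.toFinset_card] at hcard
  have hpos : 0 < Fintype.card (Q.F κ)ˣ := Fintype.card_pos
  have hunits : (Fintype.card (Q.F κ)ˣ : ℝ) = 2 ^ Q.b κ - 1 := by
    rw [Fintype.card_units, Q.card_F, Nat.cast_sub Nat.one_le_two_pow]
    simp
  rw [ENNReal.div_le_iff (by exact_mod_cast hpos.ne') (ENNReal.natCast_ne_top _),
    ← ENNReal.ofReal_natCast, ← ENNReal.ofReal_natCast,
    ← ENNReal.ofReal_mul' (Nat.cast_nonneg _), hunits]
  refine ENNReal.ofReal_le_ofReal (le_trans ?_ (hε κ))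
  exact_mod_cast hcard

/-- The queries to a coalition of at most `t` servers are uniformly distributed. -/
theorem map_que_queriesTo (htℓ : t ≤ ℓ) {κ n : ℕ} (α : Fin n) {T : Finset (Fin ℓ)}
    (hT : T.card ≤ t) :
    ((Q.scheme.que κ n α).map fun p => fun j : T => p.1 j) =
      PMF.uniformOfFintype (T → Bits (Q.b κ * (D * Q.r n))) := by
  rw [scheme_que, PMF.map_comp,
    -- Condition on `s` instead: for each `s` the queries are a translate of a uniform displacement,
    -- so the average over `s` is that of a constant.
    ← PMF.uniformOfFintype_map_equiv (Equiv.prodComm (Fin t → Q.Point κ n) (Q.F κ)ˣ),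
    PMF.uniformOfFintype_prod, PMF.map_bind, PMF.map_bind]
  refine Eq.trans ?_ (PMF.bind_const (PMF.uniformOfFintype (Q.F κ)ˣ) _)
  congr 1
  funext s
  rw [PMF.map_comp, PMF.map_comp]
  let e : (T → Q.Point κ n) ≃ (T → Bits (Q.b κ * (D * Q.r n))) :=
    (Equiv.addLeft fun _ k => (s : Q.F κ) * indexPoint (Q.F κ) (Q.code n) α k).trans
      (Equiv.piCongrRight fun _ => Q.encodeQuery κ n)
  rw [← PMF.uniformOfFintype_map_equiv e, ← PMF.uniformOfFintype_map_of_surjective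
    (displacement (F := Q.F κ) (Fin D × Fin (Q.r n)) t (Q.pts κ) T).toAddMonoidHom
    (displacement_surjective (Q.pts_injective κ) htℓ hT), PMF.map_comp]
  congr 1
  funext R j
  refine congrArg (Q.encodeQuery κ n) (funext fun k => ?_)
  exact eval_curve _ _ _ _ T j k

end CurveParams

/-! ### Perfect simulation for schemes that never reject. -/

namespace APIRScheme

variable {ℓ : ℕ} (Γ : APIRScheme ℓ)

/-- The simulator that sends uniformly random queries and always accepts. -/
noncomputable def uniformSimulator (κ n m : ℕ) (T : Finset (Fin ℓ)) : Γ.Simulator T κ n m where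
  stateLen := 0
  coins0 := T.card * Γ.qlen κ n
  coins1 := 0
  stage0 :=
    { gates := []
      out := Sum.elim Fin.elim0 fun ji => Sum.inl (Sum.inr
        (Fintype.equivFinOfCardEq (show Fintype.card (T × Fin (Γ.qlen κ n)) = _ by simp) ji)) }
  stage1 :=
    -- Gate `0` reads its own wire, which defaults to `false` when it is evaluated; the NAND is
    -- therefore constantly `true`.
    { gates := [(Sum.inr 0, Sum.inr 0)]
      out := fun _ => Sum.inr 0 }

theorem size_uniformSimulator (κ n m : ℕ) (T : Finset (Fin ℓ)) :
    (Γ.uniformSimulator κ n m T).size =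
      n * m + 2 * (T.card * Γ.qlen κ n) + T.card * Γ.alen κ n m + 2 := by
  change Fintype.card ((Fin n × Fin m) ⊕ Fin (T.card * Γ.qlen κ n)) + 0 +
      Fintype.card (Fin 0 ⊕ (T × Fin (Γ.qlen κ n))) +
    (Fintype.card ((Fin 0 ⊕ (T × Fin (Γ.alen κ n m))) ⊕ Fin 0) + 1 + Fintype.card Unit) = _
  simp only [Fintype.card_sum, Fintype.card_prod, Fintype.card_fin, Fintype.card_coe,
    Fintype.card_unit]
  ring

theorem run_stage1_uniformSimulator (κ n m : ℕ) (T : Finset (Fin ℓ))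
    (inp : Fin (Γ.uniformSimulator κ n m T).stateLen ⊕ (T × Fin (Γ.alen κ n m)) → Bool) :
    (Γ.uniformSimulator κ n m T).stage1.run inp = PMF.pure fun _ => true :=
  PMF.map_const (PMF.uniformOfFintype (Bits 0)) fun _ : Unit => true

theorem run_stage0_uniformSimulator (κ n m : ℕ) (T : Finset (Fin ℓ)) (inp : Fin n × Fin m → Bool) :
    ((Γ.uniformSimulator κ n m T).stage0.run inp).map
      (fun o (j : T) (i : Fin (Γ.qlen κ n)) => o (Sum.inr (j, i))) =
      PMF.uniformOfFintype (T → Bits (Γ.qlen κ n)) := by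
  rw [Circuit.run, PMF.map_comp]
  exact PMF.uniformOfFintype_map_equiv (((Fintype.equivFinOfCardEq
    (show Fintype.card (T × Fin (Γ.qlen κ n)) = T.card * Γ.qlen κ n by simp)).symm.arrowCongr
      (Equiv.refl Bool)).trans (Equiv.curry T (Fin (Γ.qlen κ n)) Bool))

/-- If the client never rejects and the queries to `T` are uniformly distributed, then the real
experiment is simulated perfectly. -/
theorem real_eq_ideal {κ n m : ℕ} {T : Finset (Fin ℓ)} {α : Fin n}
    (haccept : ∀ a aux, (Γ.recon κ n m a aux).isSome)
    (hunif : ((Γ.que κ n α).map fun p => fun j : T => p.1 j) = PMF.uniformOfFintype _)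
    {St B : Type} (A : Γ.Adversary T κ n m St B) (x : Database n m) :
    Γ.real A x α = Γ.ideal (Γ.uniformSimulator κ n m T) A x := by
  have hreal : Γ.real A x α = ((Γ.que κ n α).map fun p => fun j : T => p.1 j).bind fun q =>
      (A.stage0 x q).bind fun sa => A.stage1 sa.1 true := by
    rw [PMF.bind_map]
    simp only [real, output, haccept]
    rfl
  rw [hreal, hunif, ← Γ.run_stage0_uniformSimulator κ n m T fun ij => x ij.1 ij.2, PMF.bind_map]
  simp only [ideal, run_stage1_uniformSimulator, PMF.pure_bind]
  rfl

theorem statPrivate_of_uniform {t : ℕ}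
    (haccept : ∀ κ n m a aux, (Γ.recon κ n m a aux).isSome)
    (hunif : ∀ κ n (α : Fin n) (T : Finset (Fin ℓ)), T.card ≤ t →
      ((Γ.que κ n α).map fun p => fun j : T => p.1 j) = PMF.uniformOfFintype _) :
    Γ.StatPrivate t := by
  refine ⟨Γ.uniformSimulator, ⟨Polynomial.X ^ 2 + Polynomial.C (3 * t) * Polynomial.X +
    Polynomial.C 2, fun κ n m T hT => ?_⟩, 0, ?_, fun κ n m x α T hT St B _ A => ?_⟩
  · simp only [size_uniformSimulator, Polynomial.eval_add, Polynomial.eval_pow, Polynomial.eval_X,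
      Polynomial.eval_mul, Polynomial.eval_C]
    set N := κ + n + m + Γ.qlen κ n + Γ.alen κ n m
    have h1 : n * m ≤ N ^ 2 := by
      rw [sq]
      exact Nat.mul_le_mul (by omega) (by omega)
    have h2 : T.card * Γ.qlen κ n ≤ t * N := Nat.mul_le_mul hT (by omega)
    have h3 : T.card * Γ.alen κ n m ≤ t * N := Nat.mul_le_mul hT (by omega)
    rw [mul_assoc]
    omega
  · exact Asymptotics.superpolynomialDecay_zero _ _
  · rw [Γ.real_eq_ideal (haccept κ n m) (hunif κ n α T hT)]
    simp [statDist]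

end APIRScheme

namespace CurveParams

variable {ℓ t D : ℕ} (Q : CurveParams ℓ t D)

theorem scheme_statPrivate (htℓ : t ≤ ℓ) : Q.scheme.StatPrivate t :=
  Q.scheme.statPrivate_of_uniform (fun _ _ _ _ _ => rfl)
    fun _ _ α _ hT => Q.map_que_queriesTo htℓ α hT

theorem scheme_communication_le {κ n m : ℕ} (hm : 1 ≤ m) (hr : 1 ≤ D * Q.r n) :
    Q.scheme.communication κ n m ≤ 3 * m * (ℓ * Q.b κ * (D * Q.r n)) := by
  change ℓ * (Q.b κ * (D * Q.r n) + m * (Q.b κ * (D * Q.r n + 1))) ≤ _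
  have h : Q.b κ * (D * Q.r n) + m * (Q.b κ * (D * Q.r n + 1)) ≤
      m * (Q.b κ * (D * Q.r n)) + m * (Q.b κ * (D * Q.r n + D * Q.r n)) := by
    exact add_le_add (Nat.le_mul_of_pos_left _ hm) (by gcongr)
  calc _ ≤ ℓ * (m * (Q.b κ * (D * Q.r n)) + m * (Q.b κ * (D * Q.r n + D * Q.r n))) := by gcongr
    _ = _ := by ring

end CurveParams

/-! ### Choice of parameters and the communication bound. -/

/-- The number of choices per factor that suffices to encode `n` indices by `D` factors. -/
noncomputable def codeSize (D n : ℕ) : ℕ := ⌈(n : ℝ) ^ (1 / (D : ℝ))⌉₊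

theorem exists_code {D : ℕ} (hD : D ≠ 0) (n : ℕ) :
    ∃ c : Fin n → Fin D → Fin (codeSize D n), Function.Injective c := by
  have h : n ≤ codeSize D n ^ D := by
    have h1 : ((n : ℝ) ^ (1 / (D : ℝ))) ^ D ≤ (codeSize D n : ℝ) ^ D :=
      pow_le_pow_left₀ (by positivity) (Nat.le_ceil _) _
    rw [one_div, Real.rpow_inv_natCast_pow (Nat.cast_nonneg n) hD] at h1
    exact_mod_cast h1
  obtain ⟨f⟩ := Function.Embedding.nonempty_of_card_le
    (α := Fin n) (β := Fin D → Fin (codeSize D n)) (by simpa using h)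
  exact ⟨f, f.injective⟩

theorem codeSize_pos {D n : ℕ} (hn : 1 ≤ n) : 1 ≤ codeSize D n :=
  Nat.ceil_pos.2 (by positivity)

theorem codeSize_le {D n : ℕ} (hn : 1 ≤ n) :
    (codeSize D n : ℝ) ≤ 2 * (n : ℝ) ^ (1 / (D : ℝ)) := by
  have h1 : (1 : ℝ) ≤ (n : ℝ) ^ (1 / (D : ℝ)) :=
    Real.one_le_rpow (by exact_mod_cast hn) (by positivity)
  have h2 := (Nat.ceil_lt_add_one (zero_le_one.trans h1)).le
  change ((⌈(n : ℝ) ^ (1 / (D : ℝ))⌉₊ : ℕ) : ℝ) ≤ _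
  linarith

/-- The number of bits of a field element for `ℓ` servers and error probability `ε`. -/
noncomputable def fieldBits (ℓ : ℕ) (ε : ℝ) : ℕ := 3 * ℓ + ⌈Real.logb 2 ε⁻¹⌉₊

theorem le_mul_two_pow_fieldBits {ℓ D : ℕ} (hℓ : 2 ≤ ℓ) (hD : D ≤ 2 * ℓ) {ε : ℝ} (h0 : 0 < ε)
    (h1 : ε < 1) : (2 ^ ℓ * (D + 1) : ℝ) ≤ ε * (2 ^ fieldBits ℓ ε - 1) := by
  have hlog : ε⁻¹ ≤ 2 ^ ⌈Real.logb 2 ε⁻¹⌉₊ := by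
    rw [← Real.rpow_natCast, ← Real.logb_le_iff_le_rpow one_lt_two (inv_pos.2 h0)]
    exact Nat.le_ceil _
  have h2 : (1 : ℝ) ≤ ε * 2 ^ ⌈Real.logb 2 ε⁻¹⌉₊ := by
    rwa [inv_le_iff_one_le_mul₀' h0] at hlog
  have h3 : 2 * ℓ + 2 ≤ 2 ^ ℓ * 2 ^ ℓ := by
    have := Nat.lt_two_pow_self (n := ℓ)
    nlinarith
  -- The extra `1` pays for the zero of the field, which is not an admissible scalar.
  have h4 : 2 ^ ℓ * (D + 1) + 1 ≤ 2 ^ (3 * ℓ) := by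
    calc 2 ^ ℓ * (D + 1) + 1 ≤ 2 ^ ℓ * (D + 1) + 2 ^ ℓ := by gcongr; exact Nat.one_le_two_pow
      _ = 2 ^ ℓ * (D + 2) := by ring
      _ ≤ 2 ^ ℓ * (2 ^ ℓ * 2 ^ ℓ) := by gcongr; omega
      _ = 2 ^ (3 * ℓ) := by ring
  have h5 : (2 ^ ℓ * (D + 1) + 1 : ℝ) ≤ 2 ^ (3 * ℓ) := by exact_mod_cast h4
  have h6 : (2 : ℝ) ^ (3 * ℓ) * 1 ≤ 2 ^ (3 * ℓ) * (ε * 2 ^ ⌈Real.logb 2 ε⁻¹⌉₊) := by gcongr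
  rw [fieldBits, pow_add]
  linarith

/-- Since `log n ≥ log 2 > 1/2`, the term `8ℓ log n` absorbs `3ℓ` and the rounding error. -/
theorem fieldBits_le {ℓ n : ℕ} (hℓ : 2 ≤ ℓ) (hn : 2 ≤ n) {ε : ℝ} (h0 : 0 < ε) (h1 : ε < 1) :
    (fieldBits ℓ ε : ℝ) ≤ 8 * ℓ * (Real.log n + Real.log ε⁻¹) := by
  have hlog : 0 < Real.log ε⁻¹ := Real.log_pos ((one_lt_inv₀ h0).2 h1)
  have hlog2 : (1 / 2 : ℝ) < Real.log 2 := by linarith [Real.log_two_gt_d9]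
  have hn' : Real.log 2 ≤ Real.log n := Real.log_le_log two_pos (by exact_mod_cast hn)
  have hℓ' : (2 : ℝ) ≤ ℓ := by exact_mod_cast hℓ
  have hb : Real.logb 2 ε⁻¹ ≤ 2 * Real.log ε⁻¹ := by
    rw [Real.logb, div_le_iff₀ (by linarith)]
    nlinarith
  have hc := (Nat.ceil_lt_add_one (div_nonneg hlog.le (by linarith : 0 ≤ Real.log 2))).le
  rw [fieldBits]
  push_cast
  change _ + ((⌈Real.log ε⁻¹ / Real.log 2⌉₊ : ℕ) : ℝ) ≤ _
  change Real.log ε⁻¹ / Real.log 2 ≤ _ at hb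
  nlinarith

/-- Parameters of a scheme with `ℓ` servers, curves of degree `t`, and error probability `ε`. -/
theorem exists_curveParams {ℓ t D : ℕ} (hD : D ≠ 0) (hℓ : 2 ≤ ℓ) (ε : ℕ → ℝ) :
    ∃ Q : CurveParams ℓ t D, (∀ n, Q.r n = codeSize D n) ∧ ∀ κ, Q.b κ = fieldBits ℓ (ε κ) := by
  classical
  choose c hc using exists_code hD
  have hb : ∀ κ, fieldBits ℓ (ε κ) ≠ 0 := fun κ => by unfold fieldBits; omega
  let (κ : ℕ) : Fintype (GaloisField 2 (fieldBits ℓ (ε κ))) := Fintype.ofFinite _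
  have hcard : ∀ κ, Fintype.card (GaloisField 2 (fieldBits ℓ (ε κ))) = 2 ^ fieldBits ℓ (ε κ) :=
    fun κ => by rw [← Nat.card_eq_fintype_card, GaloisField.card _ _ (hb κ)]
  have hpts : ∀ κ, ∃ f : Fin ℓ → (GaloisField 2 (fieldBits ℓ (ε κ)))ˣ, Function.Injective f := by
    intro κ
    have hle : ℓ + 1 ≤ 2 ^ fieldBits ℓ (ε κ) :=
      (Nat.lt_two_pow_self (n := ℓ)).trans_le
        (Nat.pow_le_pow_right two_pos (by unfold fieldBits; omega))
    obtain ⟨f⟩ := Function.Embedding.nonempty_of_card_le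
      (α := Fin ℓ) (β := (GaloisField 2 (fieldBits ℓ (ε κ)))ˣ) (by
        rw [Fintype.card_units, hcard, Fintype.card_fin]
        omega)
    exact ⟨f, f.injective⟩
  choose pts hpts using hpts
  exact ⟨{ r := codeSize D
           code := c
           code_injective := hc
           F := fun κ => GaloisField 2 (fieldBits ℓ (ε κ))
           b := fun κ => fieldBits ℓ (ε κ)
           card_F := hcard
           pts := pts
           pts_injective := hpts }, fun _ => rfl, fun _ => rfl⟩

theorem theorem3 :
    ∃ u v : ℕ → ℝ, Tendsto u atTop (𝓝 0) ∧ Tendsto v atTop (𝓝 0) ∧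
      ∀ ℓ t : ℕ, 2 ≤ ℓ → 1 ≤ t → 2 * t < ℓ →
        ∀ ε : ℕ → ℝ, (∀ κ, 0 < ε κ ∧ ε κ < 1) →
          ∃ Γ : APIRScheme ℓ,
            Γ.Correct ∧ Γ.StatPrivate t ∧ Γ.Integrity t ε ∧
            ∀ κ n m : ℕ, 2 ≤ n → 1 ≤ m →
              (Γ.communication κ n m : ℝ) ≤
                m * ((n : ℝ) ^ (1 / (((2 * (ℓ - t) - 1) / t : ℕ) : ℝ)) *
                  (Real.log n + Real.log (ε κ)⁻¹) *
                  ((ℓ - t : ℕ) : ℝ) ^ (1 + u (ℓ - t)) * (ℓ : ℝ) ^ (2 + v ℓ)) := by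
  -- The second exponent is chosen so that `ℓ ^ v ℓ = 96`, where `96 = 3 * 8 * 2 * 2` collects the
  -- constants from the message lengths, `fieldBits_le`, `D ≤ 2(ℓ-t)` and `codeSize_le`.
  refine ⟨fun _ => 0, fun ℓ => Real.log 96 / Real.log ℓ, tendsto_const_nhds,
    tendsto_const_nhds.div_atTop (Real.tendsto_log_atTop.comp tendsto_natCast_atTop_atTop),
    fun ℓ t hℓ ht htℓ ε hε => ?_⟩
  set D := (2 * (ℓ - t) - 1) / t with hDdef
  -- The honest majority `2 * t < ℓ` gives the degree at least two that integrity needs.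
  have hD2 : 2 ≤ D := (Nat.le_div_iff_mul_le ht).2 (by omega)
  have hDle : D ≤ 2 * (ℓ - t) := (Nat.div_le_self _ _).trans (Nat.sub_le _ _)
  have hDt : t * D < 2 * (ℓ - t) := (Nat.mul_div_le _ _).trans_lt (by omega)
  obtain ⟨Q, hr, hb⟩ := exists_curveParams (t := t) (D := D) (by omega) hℓ ε
  refine ⟨Q.scheme, Q.scheme_correct (by omega) hDt, Q.scheme_statPrivate (by omega),
    Q.scheme_integrity (by omega) hDt hD2 fun κ => ?_, fun κ n m hn hm => ?_⟩
  · rw [hb]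
    exact le_mul_two_pow_fieldBits hℓ (by omega) (hε κ).1 (hε κ).2
  · have hcomm := Q.scheme_communication_le (κ := κ) (n := n) hm
      (Nat.mul_pos (by omega) (hr n ▸ codeSize_pos (by omega)))
    rw [hr, hb] at hcomm
    have hcode := codeSize_le (D := D) (n := n) (by omega)
    have hbits := fieldBits_le hℓ hn (hε κ).1 (hε κ).2
    have hlog : 0 ≤ Real.log n + Real.log (ε κ)⁻¹ := add_nonneg (Real.log_natCast_nonneg n)
      (Real.log_nonneg ((one_le_inv₀ (hε κ).1).2 (hε κ).2.le))
    have hℓ1 : (1 : ℝ) < ℓ := by exact_mod_cast hℓ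
    have hpow : (ℓ : ℝ) ^ (2 + Real.log 96 / Real.log ℓ) = ℓ ^ 2 * 96 := by
      rw [Real.rpow_add (by linarith), Real.rpow_two, Real.rpow_def_of_pos (by linarith),
        mul_div_cancel₀ _ (Real.log_pos hℓ1).ne', Real.exp_log (by norm_num)]
    rw [hpow, add_zero, Real.rpow_one]
    have hDle' : (D : ℝ) ≤ 2 * ((ℓ - t : ℕ) : ℝ) := by exact_mod_cast hDle
    calc (Q.scheme.communication κ n m : ℝ)
        ≤ 3 * m * (ℓ * fieldBits ℓ (ε κ) * (D * codeSize D n)) := by exact_mod_cast hcomm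
      _ ≤ 3 * m * (ℓ * (8 * ℓ * (Real.log n + Real.log (ε κ)⁻¹)) *
            (2 * ((ℓ - t : ℕ) : ℝ) * (2 * (n : ℝ) ^ (1 / (D : ℝ))))) := by gcongr
      _ = _ := by ring
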